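/- Let $G=(\mathcal V,\mathcal E)$ be a nonempty simple graph in which every vertex $v$ has finite degree $|v|$, and let $\mathbb Z^d$ act on $G$ by graph automorphisms $T_\gamma$, $\gamma\in\mathbb Z^d$, freely and cofinitely, with finite fundamental domain $Q\subset\mathcal V$; that is, every $v\in\mathcal V$ can be written as $v=T_\gamma q$ with exactly one $\gamma\in\mathbb Z^d$ and exactly one $q\in Q$. The Laplacian is $$(\Delta f)(v)=f(v)-\frac1{|v|}\sum_{w\sim v}f(w)$$ (the second term is $0$ if $|v|=0$). Let $m:\mathcal V\to(0,\infty)$ be a vertex weight with $m(v)/|v|=m(w)/|w|$ whenever $v\sim w$, so that $\Delta$ is a bounded self-adjoint operator on $$\ell^2(\mathcal V,m)=\Big\{f:\mathcal V\to\mathbb C:\ \sum_v m(v)|f(v)|^2<\infty\Big\},\qquad \langle f,g\rangle=\sum_v m(v)\overline{f(v)}g(v).$$ (If adjacent vertices have equal degrees, for instance if $G$ is regular, $m\equiv1$ is allowed and this is the usual $\ell^2(\mathcal V)$; on every graph one may take $m(v)=|v|$ at the vertices that are not isolated and $m(v)=1$ at the isolated ones.) For $E\in\mathbb R$ let $\chi_{(-\infty,E]}(\Delta)$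 be the spectral projector of $\Delta$ on $\ell^2(\mathcal V,m)$ and $\chi_Q$ the multiplication by the indicator function of $Q$. Then $\chi_Q\,\chi_{(-\infty,E]}(\Delta)$ is of trace class. Let $$N_G(E)=\frac1{|Q|}\operatorname{Tr}\big(\chi_Q\,\chi_{(-\infty,E]}(\Delta)\big)$$ be the integrated density of states. For $\theta\in\mathbb T^d=\mathbb R^d/(2\pi\mathbb Z)^d$ let $\Delta^\theta$ be the operator given by the same formula as $\Delta$ on the $|Q|$-dimensional space $$\ell^2(\mathcal V)_\theta=\big\{f:\mathcal V\to\mathbb C:\ f(T_\gamma v)=e^{i\langle\theta,\gamma\rangle}f(v)\ \text{for all }\gamma\in\mathbb Z^d,\ v\in\mathcal V\big\}.$$ Then the number of eigenvalues of $\Delta^\theta$ that are at most $E$, counted with multiplicity, is an integrable function of $\theta$, and $$N_G(E)=\frac1{(2\pi)^d|Q|}\int_{\mathbb T^d}\#\{\text{eigenvalues of }\Delta^\theta\text{ less than or equal to }E\}\,d\theta .$$ -/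

import Mathlib

noncomputable section

namespace PeriodicGraph

open scoped ComplexConjugate

universe u

/-! ## Weighted `ℓ²` spaces -/

/-- The complex line `ℂ` with the inner product `⟪z, w⟫ = c * conj z * w`, for a weight `c > 0`. -/
def WeightedLine (_c : Set.Ioi (0 : ℝ)) : Type := ℂ

namespace WeightedLine

variable {c : Set.Ioi (0 : ℝ)}

instance : AddCommGroup (WeightedLine c) := inferInstanceAs (AddCommGroup ℂ)

instance : Module ℂ (WeightedLine c) := inferInstanceAs (Module ℂ ℂ)

instance : FiniteDimensional ℂ (WeightedLine c) := inferInstanceAs (FiniteDimensional ℂ ℂ)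

/-- The underlying complex number. -/
def val : WeightedLine c ≃ₗ[ℂ] ℂ := LinearEquiv.refl ℂ ℂ

/-- The inner product `⟪z, w⟫ = c * conj z * w`. -/
@[reducible] def core (c : Set.Ioi (0 : ℝ)) : InnerProductSpace.Core ℂ (WeightedLine c) where
  inner z w := ((c : ℝ) : ℂ) * (conj (val z) * val w)
  conj_inner_symm z w := by simp [mul_comm]
  re_inner_nonneg z := by
    have h : ((c : ℝ) : ℂ) * (conj (val z) * val z) = (((c : ℝ) * ‖val z‖ ^ 2 : ℝ) : ℂ) := by
      rw [← Complex.normSq_eq_conj_mul_self, Complex.normSq_eq_norm_sq]; push_cast; ring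
    have hc : (0 : ℝ) < c := c.2
    rw [h]
    simp only [RCLike.re_to_complex, Complex.ofReal_re]
    positivity
  add_left x y z := by simp [add_mul, mul_add]
  smul_left x y r := by simp; ring
  definite x h := by
    have hc : ((c : ℝ) : ℂ) ≠ 0 := by exact_mod_cast (ne_of_gt c.2)
    have h2 : conj (val x) * val x = 0 := (mul_eq_zero.mp h).resolve_left hc
    have h3 : val x = 0 := by simpa using h2
    simpa using h3

instance : NormedAddCommGroup (WeightedLine c) := (core c).toNormedAddCommGroup

instance : InnerProductSpace ℂ (WeightedLine c) := InnerProductSpace.ofCore (core c).toCore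

instance : CompleteSpace (WeightedLine c) := FiniteDimensional.complete ℂ _

theorem inner_def (z w : WeightedLine c) :
    inner ℂ z w = ((c : ℝ) : ℂ) * (conj (val z) * val w) := rfl

theorem norm_sq (z : WeightedLine c) : ‖z‖ ^ 2 = (c : ℝ) * ‖val z‖ ^ 2 := by
  have h := inner_self_eq_norm_sq_to_K (𝕜 := ℂ) z
  rw [inner_def, ← Complex.normSq_eq_conj_mul_self, Complex.normSq_eq_norm_sq] at h
  have h2 : ((‖z‖ ^ 2 : ℝ) : ℂ) = (((c : ℝ) * ‖val z‖ ^ 2 : ℝ) : ℂ) := by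
    push_cast
    exact h.symm.trans (by push_cast; rfl)
  exact Complex.ofReal_injective h2

end WeightedLine

/-- The Hilbert space `ℓ²(V, m)` of all `f : V → ℂ` with `∑ m v * |f v|² < ∞` and with the inner
product `⟪f, g⟫ = ∑ m v * conj (f v) * g v`. For `m = 1` this is `ℓ²(V)`. -/
abbrev L2 {V : Type u} (m : V → Set.Ioi (0 : ℝ)) : Type u := lp (fun v => WeightedLine (m v)) 2

section Functions

variable {V : Type u} {m : V → Set.Ioi (0 : ℝ)}

/-- The elements of `ℓ²(V, m)` as functions `V → ℂ`. -/
def toFun : L2 m →ₗ[ℂ] (V → ℂ) where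
  toFun f v := (f v).val
  map_add' f g := by ext v; simp
  map_smul' c f := by ext v; simp

theorem toFun_injective : Function.Injective (toFun : L2 m →ₗ[ℂ] (V → ℂ)) := fun f g h => by
  ext v; exact WeightedLine.val.injective (congrFun h v)

theorem sum_le (f : L2 m) (s : Finset V) :
    ∑ v ∈ s, (m v : ℝ) * ‖toFun f v‖ ^ 2 ≤ ‖f‖ ^ 2 := by
  have h := lp.sum_rpow_le_norm_rpow (p := 2) (by norm_num) f s
  simp only [ENNReal.toReal_ofNat, Real.rpow_ofNat, WeightedLine.norm_sq] at h
  exact h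

/-- A linear map of functions that contracts the weighted `ℓ²`-norm, as a bounded operator
on `ℓ²(V, m)`. -/
def mkOp (A : (V → ℂ) →ₗ[ℂ] (V → ℂ))
    (hA : ∀ (f : L2 m) (s : Finset V),
      ∑ v ∈ s, (m v : ℝ) * ‖A (toFun f) v‖ ^ 2 ≤ ‖f‖ ^ 2) : L2 m →L[ℂ] L2 m :=
  have hA' : ∀ (f : L2 m) (s : Finset V),
      ∑ v ∈ s, ‖(WeightedLine.val.symm (A (toFun f) v) : WeightedLine (m v))‖
        ^ (2 : ENNReal).toReal ≤ ‖f‖ ^ (2 : ENNReal).toReal := fun f s => by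
    simpa only [ENNReal.toReal_ofNat, Real.rpow_ofNat, WeightedLine.norm_sq,
      LinearEquiv.apply_symm_apply] using hA f s
  LinearMap.mkContinuous
    { toFun := fun f => ⟨fun v => WeightedLine.val.symm (A (toFun f) v), memℓp_gen' (hA' f)⟩
      map_add' := fun f g => toFun_injective (map_add (A ∘ₗ toFun) f g)
      map_smul' := fun c f => toFun_injective (map_smul (A ∘ₗ toFun) c f) }
    1 (fun f => by
      rw [one_mul]
      exact lp.norm_le_of_forall_sum_le (by norm_num) (norm_nonneg _) (hA' f))

theorem toFun_mkOp (A : (V → ℂ) →ₗ[ℂ] (V → ℂ)) (hA) (f : L2 m) :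
    toFun (mkOp A hA f) = A (toFun f) := rfl

/-- Multiplication by the indicator function of `Q`, on functions. -/
def cutoffFun (Q : Set V) : (V → ℂ) →ₗ[ℂ] (V → ℂ) where
  toFun f := Q.indicator f
  map_add' f g := Set.indicator_add' Q f g
  map_smul' c f := Set.indicator_const_smul Q c f

/-- The operator `χ_Q` of multiplication by the indicator function of `Q` on `ℓ²(V, m)`. -/
def cutoff (m : V → Set.Ioi (0 : ℝ)) (Q : Set V) : L2 m →L[ℂ] L2 m :=
  mkOp (cutoffFun Q) fun f s => (Finset.sum_le_sum fun v _ =>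
    mul_le_mul_of_nonneg_left (pow_le_pow_left₀ (norm_nonneg _)
      (norm_indicator_le_norm_self (toFun f) v) 2) (m v).2.le).trans (sum_le f s)

theorem toFun_cutoff (Q : Set V) (f : L2 m) :
    toFun (cutoff m Q f) = Q.indicator (toFun f) := rfl

end Functions

/-! ## The Laplacian -/

section Laplacian

variable {V : Type u} (G : SimpleGraph V) [G.LocallyFinite]

/-- The averaging operator `f ↦ (v ↦ (1 / |v|) ∑_{w ∼ v} f w)` on all functions. -/
def averageFun : (V → ℂ) →ₗ[ℂ] (V → ℂ) where
  toFun f v := (1 / (G.degree v : ℂ)) * ∑ w ∈ G.neighborFinset v, f w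
  map_add' f g := by ext v; simp [Finset.sum_add_distrib, mul_add]
  map_smul' c f := by ext v; simp [Finset.mul_sum, mul_left_comm]

/-- The expression `f ↦ (v ↦ f v - (1 / |v|) ∑_{w ∼ v} f w)` on all functions. -/
def laplacianFun : (V → ℂ) →ₗ[ℂ] (V → ℂ) := LinearMap.id - averageFun G

theorem laplacianFun_apply (f : V → ℂ) (v : V) :
    laplacianFun G f v =
      f v - (1 / (G.degree v : ℂ)) * ∑ w ∈ G.neighborFinset v, f w := rfl

/-- The vertex weight `m` makes the Laplacian symmetric: `m v / |v| = m w / |w|` along every edge.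
On every graph this holds for `m v = |v|` (and any value at isolated vertices); the constant weight
`m = 1` is allowed exactly if adjacent vertices have equal degrees, as in a regular graph. -/
def IsSymmetrizing (m : V → Set.Ioi (0 : ℝ)) : Prop :=
  ∀ v w, G.Adj v w → (m v : ℝ) / G.degree v = (m w : ℝ) / G.degree w

variable {G} {m : V → Set.Ioi (0 : ℝ)}

variable (G) in
theorem exists_isSymmetrizing : ∃ m : V → Set.Ioi (0 : ℝ), IsSymmetrizing G m ∧
    ∀ v, G.degree v ≠ 0 → (m v : ℝ) = G.degree v := by
  classical
  refine ⟨fun v => if h : G.degree v = 0 then ⟨1, Set.mem_Ioi.2 one_pos⟩ else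
    ⟨G.degree v, Set.mem_Ioi.2 (by exact_mod_cast Nat.pos_of_ne_zero h)⟩, fun v w h => ?_,
    fun v h => by simp [h]⟩
  have hv : G.degree v ≠ 0 := (G.degree_pos_iff_exists_adj v).2 ⟨w, h⟩ |>.ne'
  have hw : G.degree w ≠ 0 := (G.degree_pos_iff_exists_adj w).2 ⟨v, h.symm⟩ |>.ne'
  have hv' : (G.degree v : ℝ) ≠ 0 := by exact_mod_cast hv
  have hw' : (G.degree w : ℝ) ≠ 0 := by exact_mod_cast hw
  simp [hv, hw]

variable (G) in
theorem isSymmetrizing_one_iff : IsSymmetrizing G (fun _ => ⟨1, Set.mem_Ioi.2 one_pos⟩) ↔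
    ∀ v w, G.Adj v w → G.degree v = G.degree w := by
  simp [IsSymmetrizing]

theorem weight_mul_norm_average_le (f : V → ℂ) (hm : IsSymmetrizing G m) (v : V) :
    (m v : ℝ) * ‖averageFun G f v‖ ^ 2 ≤
      ∑ w ∈ G.neighborFinset v, (m w : ℝ) / G.degree w * ‖f w‖ ^ 2 := by
  have h1 : ‖∑ w ∈ G.neighborFinset v, f w‖ ^ 2 ≤
      G.degree v * ∑ w ∈ G.neighborFinset v, ‖f w‖ ^ 2 := by
    refine (pow_le_pow_left₀ (norm_nonneg _) (norm_sum_le _ _) 2).trans ?_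
    rw [← G.card_neighborFinset_eq_degree v]
    exact sq_sum_le_card_mul_sum_sq
  have h2 : ∑ w ∈ G.neighborFinset v, (m w : ℝ) / G.degree w * ‖f w‖ ^ 2 =
      (m v : ℝ) / G.degree v * ∑ w ∈ G.neighborFinset v, ‖f w‖ ^ 2 := by
    rw [Finset.mul_sum]
    refine Finset.sum_congr rfl fun w hw => ?_
    rw [hm v w ((G.mem_neighborFinset v w).1 hw)]
  have hpos : (0 : ℝ) < m v := (m v).2
  rw [h2]
  rcases Nat.eq_zero_or_pos (G.degree v) with h0 | h0
  · simp [averageFun, h0]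
  · have hd : (0 : ℝ) < G.degree v := by exact_mod_cast h0
    have h3 : averageFun G f v = (1 / (G.degree v : ℂ)) * ∑ w ∈ G.neighborFinset v, f w := rfl
    rw [h3, norm_mul, mul_pow, norm_div, norm_one, Complex.norm_natCast]
    calc (m v : ℝ) * ((1 / (G.degree v : ℝ)) ^ 2 * ‖∑ w ∈ G.neighborFinset v, f w‖ ^ 2)
        ≤ (m v : ℝ) * ((1 / (G.degree v : ℝ)) ^ 2 *
          (G.degree v * ∑ w ∈ G.neighborFinset v, ‖f w‖ ^ 2)) := by gcongr
      _ = _ := by field_simp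

theorem sum_average_le (hm : IsSymmetrizing G m) (f : L2 m) (s : Finset V) :
    ∑ v ∈ s, (m v : ℝ) * ‖averageFun G (toFun f) v‖ ^ 2 ≤ ‖f‖ ^ 2 := by
  classical
  set a : V → ℝ := fun w => (m w : ℝ) / G.degree w * ‖toFun f w‖ ^ 2 with ha
  have ha0 : ∀ w, 0 ≤ a w := fun w =>
    mul_nonneg (div_nonneg (m w).2.le (Nat.cast_nonneg _)) (sq_nonneg _)
  calc ∑ v ∈ s, (m v : ℝ) * ‖averageFun G (toFun f) v‖ ^ 2
      ≤ ∑ v ∈ s, ∑ w ∈ G.neighborFinset v, a w :=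
        Finset.sum_le_sum fun v _ => weight_mul_norm_average_le _ hm v
    _ = ∑ w ∈ s.biUnion (fun v => G.neighborFinset v),
          ∑ v ∈ s.filter (fun v => G.Adj v w), a w := by
        refine Finset.sum_comm' fun v w => ?_
        simp only [Finset.mem_filter, Finset.mem_biUnion, SimpleGraph.mem_neighborFinset]
        exact ⟨fun h => ⟨⟨h.1, h.2⟩, v, h.1, h.2⟩, fun h => h.1⟩
    _ ≤ ∑ w ∈ s.biUnion (fun v => G.neighborFinset v), (m w : ℝ) * ‖toFun f w‖ ^ 2 := by
        refine Finset.sum_le_sum fun w _ => ?_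
        rw [Finset.sum_const, nsmul_eq_mul]
        have hcard : (s.filter (fun v => G.Adj v w)).card ≤ G.degree w := by
          rw [← G.card_neighborFinset_eq_degree w]
          refine Finset.card_le_card fun v hv => ?_
          rw [SimpleGraph.mem_neighborFinset]
          exact (Finset.mem_filter.1 hv).2.symm
        refine (mul_le_mul_of_nonneg_right (Nat.cast_le.2 hcard) (ha0 w)).trans ?_
        rcases Nat.eq_zero_or_pos (G.degree w) with h0 | h0
        · have : (0 : ℝ) ≤ m w := le_of_lt (m w).2
          rw [h0, Nat.cast_zero, zero_mul]
          exact mul_nonneg this (sq_nonneg _)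
        · have hd : (0 : ℝ) < G.degree w := by exact_mod_cast h0
          rw [ha]
          field_simp
          exact le_rfl
    _ ≤ ‖f‖ ^ 2 := sum_le f _

/-- The Laplacian `(Δ f) v = f v - (1 / |v|) ∑_{w ∼ v} f w` as a bounded operator on `ℓ²(V, m)`. -/
def laplacian (hm : IsSymmetrizing G m) : L2 m →L[ℂ] L2 m :=
  ContinuousLinearMap.id ℂ (L2 m) - mkOp (averageFun G) (sum_average_le hm)

theorem toFun_laplacian (hm : IsSymmetrizing G m) (f : L2 m) :
    toFun (laplacian hm f) = laplacianFun G (toFun f) := rfl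

theorem isSelfAdjoint_laplacian (hm : IsSymmetrizing G m) : IsSelfAdjoint (laplacian hm) := by
  classical
  have key : ∀ (v : V) (a : WeightedLine (m v)) (f : L2 m),
      inner ℂ (mkOp (averageFun G) (sum_average_le hm) (lp.single 2 v a)) f =
        inner ℂ (lp.single 2 v a) (mkOp (averageFun G) (sum_average_le hm) f) := fun v a f => by
    have h1 : ∀ w, (mkOp (averageFun G) (sum_average_le hm) (lp.single 2 v a) w).val =
        if G.Adj v w then (1 / (G.degree w : ℂ)) * a.val else 0 := fun w => by
      have h2 : (mkOp (averageFun G) (sum_average_le hm) (lp.single 2 v a) w).val =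
          (1 / (G.degree w : ℂ)) *
            ∑ u ∈ G.neighborFinset w, toFun (lp.single 2 v a : L2 m) u := rfl
      have h3 : ∀ u, toFun (lp.single 2 v a : L2 m) u = if u = v then a.val else 0 := fun u => by
        by_cases h : u = v
        · subst h; simp [toFun]
        · simp [toFun, h]
      rw [h2]
      simp only [h3, Finset.sum_ite_eq', SimpleGraph.mem_neighborFinset, G.adj_comm w v]
      split_ifs <;> simp
    rw [lp.inner_single_left, lp.inner_eq_tsum, tsum_eq_sum (s := G.neighborFinset v)]
    · have h4 : (mkOp (averageFun G) (sum_average_le hm) f v).val =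
          (1 / (G.degree v : ℂ)) * ∑ w ∈ G.neighborFinset v, (f w).val := rfl
      rw [WeightedLine.inner_def, h4, Finset.mul_sum, Finset.mul_sum, Finset.mul_sum]
      refine Finset.sum_congr rfl fun w hw => ?_
      have hvw := (G.mem_neighborFinset v w).1 hw
      have h5 : ((m v : ℝ) : ℂ) / G.degree v = ((m w : ℝ) : ℂ) / G.degree w := by
        exact_mod_cast congrArg (fun x : ℝ => (x : ℂ)) (hm v w hvw)
      rw [WeightedLine.inner_def, h1, if_pos hvw]
      simp only [map_mul, map_div₀, map_one, Complex.conj_natCast]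
      linear_combination (-(conj a.val * (f w).val)) * h5
    · intro w hw
      rw [SimpleGraph.mem_neighborFinset] at hw
      rw [WeightedLine.inner_def, h1, if_neg hw]
      simp
  have hA : IsSelfAdjoint (mkOp (averageFun G) (sum_average_le hm)) := by
    rw [ContinuousLinearMap.isSelfAdjoint_iff']
    ext f v
    refine ext_inner_left ℂ fun a => ?_
    have h := key v a f
    rw [← ContinuousLinearMap.adjoint_inner_right, lp.inner_single_left,
      lp.inner_single_left] at h
    exact h
  exact (IsSelfAdjoint.one (L2 m →L[ℂ] L2 m)).sub hA

end Laplacian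

/-! ## Spectral projectors, traces and the integrated density of states -/

section Hilbert

variable {H : Type u} [NormedAddCommGroup H] [InnerProductSpace ℂ H] [CompleteSpace H]

/-- The spectral projector `χ_{(-∞, E]}(A)` of a bounded self-adjoint operator `A`. Since
`χ_{(-∞, E]}` is the indicator function of the zero set of the continuous function
`t ↦ max (t - E) 0`, it is the orthogonal projection onto the kernel of the positive part
`(A - E)₊`, which is given by the continuous functional calculus. -/
def spectralProjector (A : H →L[ℂ] H) (E : ℝ) : H →L[ℂ] H :=
  (cfc (fun t : ℝ => max (t - E) 0) A).ker.starProjection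

/-- `T` is of trace class with trace `t`: for every orthonormal basis `b`, the family `⟪b i, T b i⟫`
is summable with sum `t`. -/
def HasTrace (T : H →L[ℂ] H) (t : ℂ) : Prop :=
  ∀ (ι : Type u) (b : HilbertBasis ι ℂ H), HasSum (fun i => inner ℂ (b i) (T (b i))) t

open Classical in
/-- The trace of a trace class operator. -/
def trace (T : H →L[ℂ] H) : ℂ := if h : ∃ t, HasTrace T t then h.choose else 0

end Hilbert

section IDS

variable {V : Type u} {G : SimpleGraph V} [G.LocallyFinite] {m : V → Set.Ioi (0 : ℝ)}

/-- The operator `χ_Q χ_{(-∞, E]}(Δ)` on `ℓ²(V, m)`. -/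
def localizedProjector (hm : IsSymmetrizing G m) (Q : Finset V) (E : ℝ) : L2 m →L[ℂ] L2 m :=
  cutoff m (Q : Set V) ∘L spectralProjector (laplacian hm) E

/-- The integrated density of states `N_G(E) = |Q|⁻¹ Tr (χ_Q χ_{(-∞, E]}(Δ))`. -/
def ids (hm : IsSymmetrizing G m) (Q : Finset V) (E : ℝ) : ℂ :=
  (1 / (Q.card : ℂ)) * trace (localizedProjector hm Q E)

end IDS

/-! ## The `ℤ^d`-action and the pseudoperiodic Laplacians -/

section Floquet

variable {V : Type u} (G : SimpleGraph V) {d : ℕ} [AddAction (Fin d → ℤ) V]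

/-- `ℤ^d` acts by graph automorphisms. -/
def ActsByAutomorphisms (d : ℕ) [AddAction (Fin d → ℤ) V] : Prop :=
  ∀ (γ : Fin d → ℤ) (v w : V), G.Adj (γ +ᵥ v) (γ +ᵥ w) ↔ G.Adj v w

/-- `Q` is a fundamental domain of the free action of `ℤ^d`: every vertex is `T_γ q` for exactly one
`γ` and one `q ∈ Q`. -/
def IsFundamentalDomain (d : ℕ) [AddAction (Fin d → ℤ) V] (Q : Finset V) : Prop :=
  ∀ v : V, ∃! p : (Fin d → ℤ) × V, p.2 ∈ Q ∧ p.1 +ᵥ p.2 = v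

instance fact_two_pi_pos : Fact ((0 : ℝ) < 2 * Real.pi) := ⟨Real.two_pi_pos⟩

/-- The torus `𝕋^d = ℝ^d / (2πℤ)^d`; its `volume` is Lebesgue measure, of total mass `(2π)^d`. -/
abbrev Torus (d : ℕ) : Type := Fin d → AddCircle (2 * Real.pi)

/-- `e^{i ⟨θ, γ⟩}`. -/
def phase (θ : Torus d) (γ : Fin d → ℤ) : ℂ := (AddCircle.toCircle (∑ j, γ j • θ j) : ℂ)

theorem volume_torus (d : ℕ) :
    (MeasureTheory.volume : MeasureTheory.Measure (Torus d)) Set.univ =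
      ENNReal.ofReal ((2 * Real.pi) ^ d) := by
  rw [← Set.pi_univ Set.univ, MeasureTheory.volume_pi_pi]
  simp [AddCircle.measure_univ, ENNReal.ofReal_pow Real.two_pi_pos.le]

theorem phase_coe (x : Fin d → ℝ) (γ : Fin d → ℤ) :
    phase (fun j => (x j : AddCircle (2 * Real.pi))) γ =
      Complex.exp (Complex.I * ∑ j, (x j : ℂ) * (γ j : ℂ)) := by
  have h : ∑ j, γ j • (x j : AddCircle (2 * Real.pi)) =
      ((∑ j, γ j • x j : ℝ) : AddCircle (2 * Real.pi)) := by
    rw [← QuotientAddGroup.coe_mk', map_sum]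
    simp
  rw [phase, h, AddCircle.toCircle_apply_mk, div_self Real.two_pi_pos.ne', one_mul,
    Circle.coe_exp, mul_comm]
  push_cast
  simp [mul_comm]

/-- The space `ℓ²(V)_θ` of functions with `f (T_γ v) = e^{i ⟨θ, γ⟩} f v` for all `γ`. -/
def pseudoperiodic (V : Type u) [AddAction (Fin d → ℤ) V] (θ : Torus d) :
    Submodule ℂ (V → ℂ) where
  carrier := {f | ∀ (γ : Fin d → ℤ) (v : V), f (γ +ᵥ v) = phase θ γ * f v}
  add_mem' := fun hf hg γ v => by simp [hf γ v, hg γ v, mul_add]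
  zero_mem' := fun γ v => by simp
  smul_mem' := fun c f hf γ v => by simp [hf γ v, mul_left_comm]

variable {G} [G.LocallyFinite]

theorem sum_neighborFinset_vadd (hG : ActsByAutomorphisms G d) (f : V → ℂ) (γ : Fin d → ℤ) (v : V) :
    ∑ w ∈ G.neighborFinset (γ +ᵥ v), f w = ∑ w ∈ G.neighborFinset v, f (γ +ᵥ w) := by
  symm
  refine Finset.sum_bij (fun w _ => γ +ᵥ w) (fun w hw => ?_) (fun w _ w' _ h => ?_)
    (fun w hw => ⟨-γ +ᵥ w, ?_, by simp⟩) (fun _ _ => rfl)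
  · rw [SimpleGraph.mem_neighborFinset] at hw ⊢
    exact (hG γ v w).2 hw
  · exact (vadd_left_cancel_iff γ).1 h
  · rw [SimpleGraph.mem_neighborFinset] at hw ⊢
    rw [← hG γ]
    simpa using hw

theorem degree_vadd (hG : ActsByAutomorphisms G d) (γ : Fin d → ℤ) (v : V) :
    G.degree (γ +ᵥ v) = G.degree v := by
  have h := sum_neighborFinset_vadd hG (fun _ => 1) γ v
  simpa using h

theorem laplacianFun_mem_pseudoperiodic (hG : ActsByAutomorphisms G d) (θ : Torus d) (f : V → ℂ)
    (hf : f ∈ pseudoperiodic V θ) : laplacianFun G f ∈ pseudoperiodic V θ := by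
  intro γ v
  rw [laplacianFun_apply, laplacianFun_apply, sum_neighborFinset_vadd hG, degree_vadd hG, hf γ v,
    Finset.sum_congr rfl (fun w _ => hf γ w), ← Finset.mul_sum]
  ring

/-- The `θ`-pseudoperiodic Laplacian `Δ^θ` on `ℓ²(V)_θ`. -/
def floquetLaplacian (hG : ActsByAutomorphisms G d) (θ : Torus d) :
    Module.End ℂ (pseudoperiodic V θ) :=
  (laplacianFun G).restrict (laplacianFun_mem_pseudoperiodic hG θ)

/-- The number of eigenvalues of `Δ^θ` that are at most `E`, counted with multiplicity. -/
def eigenvalueCount (hG : ActsByAutomorphisms G d) (θ : Torus d) (E : ℝ) : ℕ :=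
  ∑ᶠ (μ : ℝ) (_ : μ ≤ E),
    Module.finrank ℂ (Module.End.eigenspace (floquetLaplacian hG θ) (μ : ℂ))

end Floquet

end PeriodicGraph

end

/-! Both sides are integrals of the indicator function of $(-\infty,E]$ against spectral measures in
the energy variable, and these measures agree because their moments do. No direct integral
decomposition of $\ell^2(\mathcal V,m)$ is needed.

Moments: the functions $\delta_q^\theta$, $q\in Q$, extending the indicator of $\{q\}$
pseudoperiodically, form a basis of $\ell^2(\mathcal V)_\theta$, so
$\operatorname{Tr}(\Delta^\theta)^k=\sum_q(\Delta^k\delta_q^\theta)(q)$. As $\Delta^k$ involves only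
finite sums, the integral over $\theta$ passes inside it, and orthogonality of characters gives
$\int\delta_q^\theta\,d\theta=(2\pi)^d\delta_q$. Hence
$\int\operatorname{Tr}(\Delta^\theta)^k\,d\theta=(2\pi)^d\sum_q\langle e_q,\Delta^ke_q\rangle$ with
$e_q=\delta_q/\sqrt{m(q)}$ (`traceIdentity_pow`).

From moments to the indicator: linearity gives polynomials. Weierstrass approximation on $[-2,2]$,
which contains all spectra involved, gives continuous functions (`TraceIdentity.continuous`). A
bounded pointwise limit gives the indicator, since the approximants applied to $\Delta$ converge
strongly to the spectral projector (`tendsto_cfc_cutoffApprox`).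

Finally, $\chi_Q=\sum_q|e_q\rangle\langle e_q|$ has finite rank, which turns the right side into the
trace (`hasTrace_comp_of_eq_sum`). Each $\Delta^\theta$ is diagonalizable with real eigenvalues
(`exists_floquet_eigenbasis`), so the sums over eigenvalues do count them with multiplicity. -/

noncomputable section

namespace PeriodicGraph

universe u

open Filter MeasureTheory Topology Polynomial
open scoped ComplexConjugate

/-! ### Spectral projectors as strong limits of the continuous functional calculus; traces -/

section Spectral

variable {H : Type u} [NormedAddCommGroup H] [InnerProductSpace ℂ H] [CompleteSpace H]

/-- A continuous approximation of the indicator function of `(-∞, E]`, decreasing in `n`. -/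
def cutoffApprox (E : ℝ) (n : ℕ) (t : ℝ) : ℝ := (1 + n * max (t - E) 0)⁻¹

theorem one_le_one_add_mul_max (E : ℝ) (n : ℕ) (t : ℝ) : 1 ≤ 1 + n * max (t - E) 0 :=
  le_add_of_nonneg_right (mul_nonneg (Nat.cast_nonneg _) (le_max_right _ _))

theorem continuous_cutoffApprox (E : ℝ) (n : ℕ) : Continuous (cutoffApprox E n) := by
  refine Continuous.inv₀ (by fun_prop) fun t => ?_
  have := one_le_one_add_mul_max E n t
  positivity

theorem cutoffApprox_nonneg (E : ℝ) (n : ℕ) (t : ℝ) : 0 ≤ cutoffApprox E n t :=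
  inv_nonneg.2 (zero_le_one.trans (one_le_one_add_mul_max E n t))

theorem cutoffApprox_le_one (E : ℝ) (n : ℕ) (t : ℝ) : cutoffApprox E n t ≤ 1 :=
  inv_le_one_of_one_le₀ (one_le_one_add_mul_max E n t)

theorem tendsto_cutoffApprox (E t : ℝ) :
    Tendsto (fun n => cutoffApprox E n t) atTop (𝓝 (if t ≤ E then 1 else 0)) := by
  split_ifs with h
  · have : ∀ n, cutoffApprox E n t = 1 := fun n => by simp [cutoffApprox, h]
    simp [this]
  · have hpos : 0 < max (t - E) 0 := lt_max_of_lt_left (sub_pos.2 (not_le.1 h))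
    exact tendsto_inv_atTop_zero.comp (tendsto_atTop_add_const_left _ _
      (tendsto_natCast_atTop_atTop.atTop_mul_const hpos))

/-- This identity drives the strong limit: read in the functional calculus, it makes the approximant
the identity on the kernel of $(A-E)_+$, and its second summand bounds the approximant times
$(A-E)_+$ by $1/n$. -/
theorem cutoffApprox_add (E : ℝ) (n : ℕ) (t : ℝ) :
    cutoffApprox E n t + n * (cutoffApprox E n t * max (t - E) 0) = 1 := by
  have := one_le_one_add_mul_max E n t
  have h : 1 + n * max (t - E) 0 ≠ 0 := by positivity
  rw [cutoffApprox]
  field_simp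

theorem norm_cfc_cutoffApprox_le (A : H →L[ℂ] H) (E : ℝ) (n : ℕ) :
    ‖cfc (cutoffApprox E n) A‖ ≤ 1 :=
  norm_cfc_le zero_le_one fun t _ => by
    rw [Real.norm_of_nonneg (cutoffApprox_nonneg E n t)]
    exact cutoffApprox_le_one E n t

theorem cfc_cutoffApprox_mul {A : H →L[ℂ] H} (_hA : IsSelfAdjoint A) (E : ℝ) (n : ℕ) :
    cfc (fun t => cutoffApprox E n t * max (t - E) 0) A =
      cfc (cutoffApprox E n) A * cfc (fun t : ℝ => max (t - E) 0) A :=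
  cfc_mul _ _ _ (continuous_cutoffApprox E n).continuousOn (by fun_prop)

theorem cfc_cutoffApprox_apply_of_mem_ker {A : H →L[ℂ] H} (hA : IsSelfAdjoint A) (E : ℝ) (n : ℕ)
    {x : H} (hx : cfc (fun t : ℝ => max (t - E) 0) A x = 0) :
    cfc (cutoffApprox E n) A x = x := by
  have hc := continuous_cutoffApprox E n
  have h : cfc (cutoffApprox E n) A +
      (n : ℝ) • (cfc (cutoffApprox E n) A * cfc (fun t : ℝ => max (t - E) 0) A) = 1 := by
    rw [← cfc_cutoffApprox_mul hA, ← cfc_smul (n : ℝ) _ A (by fun_prop),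
      ← cfc_add (a := A) _ _ (by fun_prop) (by fun_prop)]
    simp only [smul_eq_mul, cutoffApprox_add]
    exact cfc_const_one ℝ A
  have h2 := DFunLike.congr_fun h x
  simpa [hx] using h2

theorem tendsto_cfc_cutoffApprox_of_range {A : H →L[ℂ] H} (hA : IsSelfAdjoint A) (E : ℝ) (y : H) :
    Tendsto (fun n => cfc (cutoffApprox E n) A (cfc (fun t : ℝ => max (t - E) 0) A y)) atTop
      (𝓝 0) := by
  refine squeeze_zero_norm' (a := fun n : ℕ => (1 / (n : ℝ)) * ‖y‖) ?_ ?_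
  · filter_upwards [eventually_gt_atTop 0] with n hn
    have hn' : (0 : ℝ) < n := by exact_mod_cast hn
    have h1 : ‖cfc (fun t => cutoffApprox E n t * max (t - E) 0) A‖ ≤ 1 / n := by
      refine norm_cfc_le (by positivity) fun t _ => ?_
      rw [Real.norm_of_nonneg (mul_nonneg (cutoffApprox_nonneg E n t) (le_max_right _ _)),
        le_div_iff₀' hn']
      have h2 := cutoffApprox_add E n t
      have h3 := cutoffApprox_nonneg E n t
      linarith
    rw [cfc_cutoffApprox_mul hA] at h1
    exact ContinuousLinearMap.le_of_opNorm_le _ h1 y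
  · simpa using (tendsto_one_div_atTop_nhds_zero_nat (𝕜 := ℝ)).mul_const ‖y‖

/-- The approximants are uniformly bounded by 1, so convergence to 0 on the range extends to its
closure. -/
theorem tendsto_cfc_cutoffApprox_of_closure {A : H →L[ℂ] H} (hA : IsSelfAdjoint A) (E : ℝ) {x : H}
    (hx : x ∈ (cfc (fun t : ℝ => max (t - E) 0) A).range.topologicalClosure) :
    Tendsto (fun n => cfc (cutoffApprox E n) A x) atTop (𝓝 0) := by
  rw [Metric.tendsto_atTop]
  intro ε hε
  obtain ⟨z, ⟨y, rfl⟩, hz⟩ := Metric.mem_closure_iff.1 hx (ε / 2) (half_pos hε)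
  obtain ⟨N, hN⟩ := Metric.tendsto_atTop.1 (tendsto_cfc_cutoffApprox_of_range hA E y) (ε / 2)
    (half_pos hε)
  refine ⟨N, fun n hn => ?_⟩
  have h1 := hN n hn
  set w := cfc (fun t : ℝ => max (t - E) 0) A y with hw
  change dist x w < ε / 2 at hz
  rw [dist_zero_right] at h1 ⊢
  have h2 : ‖cfc (cutoffApprox E n) A (x - w)‖ ≤ ‖x - w‖ := by
    simpa using ContinuousLinearMap.le_of_opNorm_le _ (norm_cfc_cutoffApprox_le A E n) (x - w)
  rw [dist_eq_norm] at hz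
  calc ‖cfc (cutoffApprox E n) A x‖
      = ‖cfc (cutoffApprox E n) A (x - w) + cfc (cutoffApprox E n) A w‖ := by simp
    _ < ε := by
      refine (norm_add_le _ _).trans_lt ?_
      linarith

/-- Since $(A-E)_+$ is self-adjoint, $H$ splits into its kernel, where the approximants are the
identity, and the closure of its range, where they tend to 0. -/
theorem tendsto_cfc_cutoffApprox {A : H →L[ℂ] H} (hA : IsSelfAdjoint A) (E : ℝ) (x : H) :
    Tendsto (fun n => cfc (cutoffApprox E n) A x) atTop (𝓝 (spectralProjector A E x)) := by
  set g := cfc (fun t : ℝ => max (t - E) 0) A with hg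
  have hgs : IsSelfAdjoint g := cfc_predicate _ _
  have hk : spectralProjector A E x ∈ g.ker := Submodule.starProjection_apply_mem _ _
  have ho : x - spectralProjector A E x ∈ g.range.topologicalClosure := by
    have h1 : x - spectralProjector A E x ∈ g.kerᗮ := Submodule.sub_starProjection_mem_orthogonal x
    rw [ContinuousLinearMap.orthogonal_ker, hgs.adjoint_eq] at h1
    exact h1
  have h := (tendsto_cfc_cutoffApprox_of_closure hA E ho).add_const (spectralProjector A E x)
  rw [zero_add] at h
  refine h.congr fun n => ?_
  rw [map_sub, cfc_cutoffApprox_apply_of_mem_ker hA E n (LinearMap.mem_ker.1 hk)]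
  simp

theorem isSelfAdjoint_spectralProjector (A : H →L[ℂ] H) (E : ℝ) :
    IsSelfAdjoint (spectralProjector A E) :=
  isSelfAdjoint_starProjection _

theorem HasTrace.unique {T : H →L[ℂ] H} {s t : ℂ} (hs : HasTrace T s) (ht : HasTrace T t) :
    s = t := by
  obtain ⟨w, b, -⟩ := exists_hilbertBasis ℂ H
  exact (hs w b).unique (ht w b)

theorem HasTrace.trace_eq {T : H →L[ℂ] H} {t : ℂ} (ht : HasTrace T t) : trace T = t := by
  have h : ∃ t, HasTrace T t := ⟨t, ht⟩
  rw [trace, dif_pos h]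
  exact h.choose_spec.unique ht

/-- The trace of a finite rank operator `∑ |e⟩⟨e|` times a self-adjoint operator. -/
theorem hasTrace_comp_of_eq_sum {ι : Type*} (s : Finset ι) (e : ι → H) {C P : H →L[ℂ] H}
    (hC : ∀ x, C x = ∑ q ∈ s, inner ℂ (e q) x • e q) (hP : IsSelfAdjoint P) :
    HasTrace (C ∘L P) (∑ q ∈ s, inner ℂ (e q) (P (e q))) := by
  intro κ b
  have hP' : ∀ x y, inner ℂ x (P y) = inner ℂ (P x) y := fun x y => by
    rw [← ContinuousLinearMap.adjoint_inner_left, hP.adjoint_eq]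
  -- Moving the self-adjoint $P$ to the other side makes each term a Parseval sum for $\langle
  -- Pe_q,e_q\rangle$.
  have h : ∀ i, inner ℂ (b i) ((C ∘L P) (b i)) =
      ∑ q ∈ s, inner ℂ (P (e q)) (b i) * inner ℂ (b i) (e q) := fun i => by
    rw [ContinuousLinearMap.comp_apply, hC, inner_sum]
    simp only [inner_smul_right, hP']
  simp only [h, hP']
  exact hasSum_sum fun q _ => b.hasSum_inner_mul_inner _ _

end Spectral

/-! ### Counting eigenvalues with an eigenbasis -/

section Eigenbasis

variable {W : Type*} [AddCommGroup W] [Module ℂ W]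

/-- The inner product is an argument because the spaces of pseudoperiodic functions carry no
canonical one; the conclusion is purely algebraic. -/
theorem exists_eigenbasis [FiniteDimensional ℂ W] (c : InnerProductSpace.Core ℂ W)
    (T : Module.End ℂ W) (hT : ∀ x y, c.inner (T x) y = c.inner x (T y)) {n : ℕ}
    (hn : Module.finrank ℂ W = n) :
    ∃ (b : Module.Basis (Fin n) ℂ W) (l : Fin n → ℝ), ∀ i, T (b i) = (l i : ℂ) • b i := by
  let := c.toNormedAddCommGroup
  let := InnerProductSpace.ofCore c.toCore
  have hs : T.IsSymmetric := hT
  exact ⟨(hs.eigenvectorBasis hn).toBasis, hs.eigenvalues hn, fun i => by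
    simp [hs.apply_eigenvectorBasis hn i]⟩

variable {ι : Type*} [Fintype ι] {T : Module.End ℂ W} (b : Module.Basis ι ℂ W) {l : ι → ℝ}

theorem finrank_eigenspace_eq_card (hT : ∀ i, T (b i) = (l i : ℂ) • b i) (μ : ℝ) :
    Module.finrank ℂ (Module.End.eigenspace T (μ : ℂ)) =
      (Finset.univ.filter fun i => l i = μ).card := by
  classical
  have hrepr : ∀ x i, b.repr (T x) i = l i * b.repr x i := fun x i => by
    have h : b.coord i ∘ₗ T = (l i : ℂ) • b.coord i := b.ext fun j => by
      rw [LinearMap.comp_apply, hT, map_smul, LinearMap.smul_apply, b.coord_apply, b.repr_self,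
        Finsupp.single_apply]
      split_ifs with hji
      · rw [hji]
      · simp only [smul_zero]
    exact LinearMap.congr_fun h x
  -- $T$ multiplies the $i$-th coordinate by $l_i$, so an eigenvector for $\mu$ is supported on the
  -- indices with $l_i=\mu$.
  have h : Module.End.eigenspace T (μ : ℂ) =
      Submodule.span ℂ (Set.range fun i : {i // l i = μ} => b i) := by
    have hr : (Set.range fun i : {i // l i = μ} => b i) = b '' {i | l i = μ} := by
      ext x; simp
    ext x
    rw [hr, b.mem_span_image, Module.End.mem_eigenspace_iff]
    constructor
    · intro hx i hi
      have h1 := hrepr x i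
      rw [hx] at h1
      simp only [map_smul, Finsupp.smul_apply, smul_eq_mul] at h1
      have h2 := mul_right_cancel₀ (Finsupp.mem_support_iff.1 hi) h1
      exact_mod_cast h2.symm
    · intro hx
      refine b.repr.injective (Finsupp.ext fun i => ?_)
      rw [hrepr, map_smul, Finsupp.smul_apply, smul_eq_mul]
      by_cases hi : b.repr x i = 0
      · simp [hi]
      · have : l i = μ := hx (Finsupp.mem_support_iff.2 hi)
        simp [this]
  rw [h, ← Fintype.card_subtype]
  exact finrank_span_eq_card (b.linearIndependent.comp _ Subtype.val_injective)

theorem finsum_finrank_eigenspace (hT : ∀ i, T (b i) = (l i : ℂ) • b i) (E : ℝ) :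
    ∑ᶠ (μ : ℝ) (_ : μ ≤ E), Module.finrank ℂ (Module.End.eigenspace T (μ : ℂ)) =
      (Finset.univ.filter fun i => l i ≤ E).card := by
  classical
  -- Only values of $l$ have nonzero eigenspaces, so the support is finite and `finsum` does not
  -- take its default value 0.
  rw [finsum_cond_eq_sum_of_cond_iff (p := (· ≤ E)) _ (t := (Finset.univ.image l).filter (· ≤ E))]
  · rw [Finset.sum_congr rfl fun μ _ => finrank_eigenspace_eq_card b hT μ,
      Finset.sum_card_fiberwise_eq_card_filter]
    simp
  · intro μ hμ
    rw [finrank_eigenspace_eq_card b hT, Finset.card_ne_zero] at hμ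
    obtain ⟨i, hi⟩ := hμ
    simp only [Finset.mem_filter, Finset.mem_univ, true_and] at hi
    simp [← hi]

theorem trace_pow_eq_sum_pow (hT : ∀ i, T (b i) = (l i : ℂ) • b i) (k : ℕ) :
    LinearMap.trace ℂ W (T ^ k) = ∑ i, ((l i ^ k : ℝ) : ℂ) := by
  classical
  have h : ∀ i, (T ^ k) (b i) = ((l i ^ k : ℝ) : ℂ) • b i := fun i => by
    induction k with
    | zero => simp
    | succ k ih =>
      rw [pow_succ', Module.End.mul_apply, ih, map_smul, hT, smul_smul, pow_succ]
      push_cast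
      rfl
  rw [LinearMap.trace_eq_matrix_trace ℂ b, Matrix.trace]
  simp [LinearMap.toMatrix_apply, h]

end Eigenbasis

/-! ### From moments to the indicator function -/

section Moments

variable {Θ : Type*} [MeasurableSpace Θ] {ν : Measure Θ}
  {ι κ : Type*} [Fintype ι] {l : Θ → ι → ℝ} {H : Type*} [NormedAddCommGroup H]
  [InnerProductSpace ℂ H] [CompleteSpace H] {A : H →L[ℂ] H} {s : Finset κ} {e : κ → H} {c : ℝ}

/-- `∫ ∑ f (l θ i) dθ = c * ∑ ⟪e q, f(A) e q⟫`. -/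
def TraceIdentity (ν : Measure Θ) (l : Θ → ι → ℝ) (A : H →L[ℂ] H) (s : Finset κ) (e : κ → H)
    (c : ℝ) (f : ℝ → ℝ) : Prop :=
  Integrable (fun θ => ∑ i, f (l θ i)) ν ∧
    ((∫ θ, ∑ i, f (l θ i) ∂ν : ℝ) : ℂ) = c * ∑ q ∈ s, inner ℂ (e q) (cfc f A (e q))

theorem TraceIdentity.polynomial (_hA : IsSelfAdjoint A)
    (h : ∀ k : ℕ, TraceIdentity ν l A s e c (fun t => t ^ k)) (p : ℝ[X]) :
    TraceIdentity ν l A s e c (fun t => p.eval t) := by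
  induction p using Polynomial.induction_on' with
  | add p q hp hq =>
    refine ⟨?_, ?_⟩
    · simp only [eval_add, Finset.sum_add_distrib]
      exact hp.1.add hq.1
    · simp only [eval_add, Finset.sum_add_distrib]
      rw [integral_add hp.1 hq.1, cfc_add (a := A) _ _ (by fun_prop) (by fun_prop)]
      push_cast
      rw [hp.2, hq.2, ← mul_add, ← Finset.sum_add_distrib]
      simp only [Pi.add_apply, inner_add_right]
  | monomial k a =>
    refine ⟨?_, ?_⟩
    · simpa only [eval_monomial, ← Finset.mul_sum] using (h k).1.const_mul a
    · simp only [eval_monomial, ← Finset.mul_sum]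
      have h2 : cfc (fun t : ℝ => a * t ^ k) A = a • cfc (fun t : ℝ => t ^ k) A :=
        cfc_const_mul a _ A (by fun_prop)
      rw [integral_const_mul, h2]
      push_cast
      have h3 := (h k).2
      push_cast at h3
      have h4 : ∀ x y : H, inner ℂ x (a • y) = (a : ℂ) * inner ℂ x y := fun x y => by
        rw [← inner_smul_right, Complex.coe_smul]
      rw [h3]
      simp only [Pi.smul_apply, h4, ← Finset.mul_sum]
      ring

variable [IsFiniteMeasure ν]

/-- Dominated convergence on the left, strong convergence on the right. The limit is an arbitrary
map $P$ so that it can be either `cfc f A` or a spectral projector, where $f$ is discontinuous.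
Measurability of the limit comes from the approximants; none is assumed of $l$. -/
theorem TraceIdentity.of_tendsto {f : ℝ → ℝ} {F : ℕ → ℝ → ℝ} {B : ℝ}
    (hF : ∀ n, TraceIdentity ν l A s e c (F n)) (hB : ∀ n θ i, |F n (l θ i)| ≤ B)
    (hlim : ∀ θ i, Tendsto (fun n => F n (l θ i)) atTop (𝓝 (f (l θ i))))
    {P : H → H} (hP : ∀ x, Tendsto (fun n => cfc (F n) A x) atTop (𝓝 (P x))) :
    Integrable (fun θ => ∑ i, f (l θ i)) ν ∧
      ((∫ θ, ∑ i, f (l θ i) ∂ν : ℝ) : ℂ) = c * ∑ q ∈ s, inner ℂ (e q) (P (e q)) := by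
  have hlim' : ∀ θ, Tendsto (fun n => ∑ i, F n (l θ i)) atTop (𝓝 (∑ i, f (l θ i))) :=
    fun θ => tendsto_finsetSum _ fun i _ => hlim θ i
  have hb : ∀ n θ, ‖∑ i, F n (l θ i)‖ ≤ Fintype.card ι * B := fun n θ => by
    refine (norm_sum_le _ _).trans ((Finset.sum_le_sum fun i _ => hB n θ i).trans ?_)
    simp
  have hb' : ∀ θ, ‖∑ i, f (l θ i)‖ ≤ Fintype.card ι * B := fun θ =>
    le_of_tendsto (hlim' θ).norm (Eventually.of_forall fun n => hb n θ)
  have hmeas : AEStronglyMeasurable (fun θ => ∑ i, f (l θ i)) ν :=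
    aestronglyMeasurable_of_tendsto_ae atTop (fun n => (hF n).1.1)
      (Eventually.of_forall hlim')
  refine ⟨Integrable.of_bound hmeas _ (Eventually.of_forall hb'), ?_⟩
  have h1 := tendsto_integral_of_dominated_convergence (fun _ => Fintype.card ι * B)
    (fun n => (hF n).1.1) (integrable_const _) (fun n => Eventually.of_forall (hb n))
    (Eventually.of_forall hlim')
  have h2 : Tendsto (fun n => (c : ℂ) * ∑ q ∈ s, inner ℂ (e q) (cfc (F n) A (e q))) atTop
      (𝓝 (c * ∑ q ∈ s, inner ℂ (e q) (P (e q)))) :=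
    (tendsto_finsetSum _ fun q _ => tendsto_const_nhds.inner (hP (e q))).const_mul _
  refine tendsto_nhds_unique ((Complex.continuous_ofReal.tendsto _).comp h1) (h2.congr fun n => ?_)
  exact (hF n).2.symm

theorem TraceIdentity.continuous (hA : IsSelfAdjoint A) {R : ℝ} (hAR : ‖A‖ ≤ R)
    (hl : ∀ θ i, |l θ i| ≤ R) (h : ∀ k : ℕ, TraceIdentity ν l A s e c (fun t => t ^ k))
    {f : ℝ → ℝ} (hf : Continuous f) : TraceIdentity ν l A s e c f := by
  have hε : ∀ n : ℕ, (0 : ℝ) < 1 / ((n : ℝ) + 1) := fun n => Nat.one_div_pos_of_nat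
  choose p hp using fun n : ℕ =>
    exists_polynomial_near_of_continuousOn (-R) R f hf.continuousOn _ (hε n)
  obtain ⟨B, hB⟩ := (isCompact_Icc (a := -R) (b := R)).exists_bound_of_continuousOn
    hf.continuousOn
  have h1 : ∀ n : ℕ, (1 : ℝ) / ((n : ℝ) + 1) ≤ 1 := fun n => by
    rw [div_le_one (by positivity)]
    exact le_add_of_nonneg_left (Nat.cast_nonneg n)
  have hz : Tendsto (fun n : ℕ => (1 : ℝ) / ((n : ℝ) + 1)) atTop (𝓝 0) :=
    tendsto_one_div_add_atTop_nhds_zero_nat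
  -- The approximation errors $1/(n+1)$ are at most 1, whence the common bound $1+B$.
  refine TraceIdentity.of_tendsto (F := fun n t => (p n).eval t) (B := 1 + B)
    (P := fun x => cfc f A x) (fun n => TraceIdentity.polynomial hA h (p n))
    (fun n θ i => ?_) (fun θ i => ?_) (fun x => ?_)
  · have h2 := hp n (l θ i) (abs_le.1 (hl θ i))
    have h3 := hB (l θ i) (abs_le.1 (hl θ i))
    rw [Real.norm_eq_abs] at h3
    have h4 := abs_sub_abs_le_abs_sub ((p n).eval (l θ i)) (f (l θ i))
    linarith [h1 n]
  · rw [tendsto_iff_dist_tendsto_zero]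
    exact squeeze_zero (fun _ => dist_nonneg)
      (fun n => (hp n (l θ i) (abs_le.1 (hl θ i))).le) hz
  · rw [tendsto_iff_dist_tendsto_zero]
    refine squeeze_zero (g := fun n : ℕ => 1 / ((n : ℝ) + 1) * ‖x‖) (fun _ => dist_nonneg)
      (fun n => ?_) (by simpa using hz.mul_const ‖x‖)
    have h2 : ‖cfc (fun t => (p n).eval t) A - cfc f A‖ ≤ 1 / ((n : ℝ) + 1) := by
      rw [← cfc_sub (a := A) _ _ (by fun_prop) (by fun_prop)]
      refine norm_cfc_le (hε n).le fun t ht => (hp n t (abs_le.1 ?_)).le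
      have h3 := spectrum.norm_le_norm_mul_of_mem ht
      -- Only an inequality, since $H$ may be trivial.
      have h4 : ‖(1 : H →L[ℂ] H)‖ ≤ 1 := ContinuousLinearMap.norm_id_le
      rw [Real.norm_eq_abs] at h3
      nlinarith [norm_nonneg A]
    rw [dist_eq_norm]
    exact ContinuousLinearMap.le_of_opNorm_le _ h2 x

theorem integral_card_eq_sum_spectralProjector (hA : IsSelfAdjoint A) {R : ℝ} (hAR : ‖A‖ ≤ R)
    (hl : ∀ θ i, |l θ i| ≤ R) (h : ∀ k : ℕ, TraceIdentity ν l A s e c (fun t => t ^ k)) (E : ℝ) :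
    Integrable (fun θ => ((Finset.univ.filter fun i => l θ i ≤ E).card : ℝ)) ν ∧
      ((∫ θ, ((Finset.univ.filter fun i => l θ i ≤ E).card : ℝ) ∂ν : ℝ) : ℂ) =
        c * ∑ q ∈ s, inner ℂ (e q) (spectralProjector A E (e q)) := by
  have h1 := TraceIdentity.of_tendsto (f := fun t => if t ≤ E then 1 else 0) (B := 1)
    (fun n => TraceIdentity.continuous hA hAR hl h (continuous_cutoffApprox E n))
    (fun n θ i => (abs_of_nonneg (cutoffApprox_nonneg E n _)).trans_le
      (cutoffApprox_le_one E n _))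
    (fun θ i => tendsto_cutoffApprox E (l θ i)) (tendsto_cfc_cutoffApprox hA E)
  simpa only [Finset.sum_boole] using h1

end Moments

/-! ### Characters of the torus -/

section Phase

variable {d : ℕ}

theorem phase_zero_right (θ : Torus d) : phase θ 0 = 1 := by simp [phase]

theorem phase_add_right (θ : Torus d) (γ γ' : Fin d → ℤ) :
    phase θ (γ + γ') = phase θ γ * phase θ γ' := by
  simp [phase, add_smul, Finset.sum_add_distrib, AddCircle.toCircle_add]

theorem phase_add_left (θ θ' : Torus d) (γ : Fin d → ℤ) :
    phase (θ + θ') γ = phase θ γ * phase θ' γ := by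
  simp [phase, smul_add, Finset.sum_add_distrib, AddCircle.toCircle_add]

theorem norm_phase (θ : Torus d) (γ : Fin d → ℤ) : ‖phase θ γ‖ = 1 := Circle.norm_coe _

theorem conj_phase_mul_phase (θ : Torus d) (γ : Fin d → ℤ) : conj (phase θ γ) * phase θ γ = 1 := by
  rw [← Complex.normSq_eq_conj_mul_self, Complex.normSq_eq_norm_sq, norm_phase]
  simp

theorem continuous_phase (γ : Fin d → ℤ) : Continuous fun θ : Torus d => phase θ γ :=
  continuous_subtype_val.comp (AddCircle.continuous_toCircle.comp (by fun_prop))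

theorem exists_phase_ne_one {γ : Fin d → ℤ} (hγ : γ ≠ 0) : ∃ s : Torus d, phase s γ ≠ 1 := by
  obtain ⟨j, hj⟩ := Function.ne_iff.1 hγ
  have hj' : (γ j : ℝ) ≠ 0 := by exact_mod_cast hj
  -- Chosen so that the phase is $e^{i\pi}=-1$.
  refine ⟨fun i => ((if i = j then Real.pi / γ j else 0 : ℝ) : AddCircle (2 * Real.pi)), ?_⟩
  rw [phase_coe, Finset.sum_eq_single j (fun i _ hi => by simp [hi]) (by simp)]
  have h : ((γ j : ℤ) : ℂ) ≠ 0 := by exact_mod_cast hj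
  have h2 : Complex.I * ((if j = j then Real.pi / γ j else 0 : ℝ) * (γ j : ℂ)) =
      Real.pi * Complex.I := by
    rw [if_pos rfl]
    push_cast
    field_simp
  rw [h2, Complex.exp_pi_mul_I]
  norm_num

theorem integral_phase (γ : Fin d → ℤ) :
    ∫ θ : Torus d, phase θ γ = if γ = 0 then (((2 * Real.pi) ^ d : ℝ) : ℂ) else 0 := by
  split_ifs with h
  · subst h
    simp only [phase_zero_right, integral_const, Measure.real, volume_torus]
    rw [ENNReal.toReal_ofReal (pow_nonneg Real.two_pi_pos.le d)]
    simp
  · obtain ⟨s, hs⟩ := exists_phase_ne_one h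
    -- Translation by $s$ multiplies the integral by a phase different from 1, so the integral
    -- vanishes.
    have h1 := integral_add_left_eq_self (μ := (volume : Measure (Torus d)))
      (fun θ => phase θ γ) s
    simp only [phase_add_left, integral_const_mul] at h1
    exact (mul_left_eq_self₀.1 h1).resolve_left hs

end Phase

/-! ### Coordinates given by the fundamental domain; mass transport -/

section FundamentalDomain

variable {V : Type u} {d : ℕ} [AddAction (Fin d → ℤ) V] {Q : Finset V}

namespace IsFundamentalDomain

variable (hQ : IsFundamentalDomain d Q)

/-- The element `γ` in `v = T_γ q`. -/
def shift (v : V) : Fin d → ℤ := (hQ v).choose.1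

/-- The vertex `q ∈ Q` in `v = T_γ q`. -/
def base (v : V) : V := (hQ v).choose.2

theorem base_mem (v : V) : hQ.base v ∈ Q := (hQ v).choose_spec.1.1

theorem shift_vadd_base (v : V) : hQ.shift v +ᵥ hQ.base v = v := (hQ v).choose_spec.1.2

theorem neg_shift_vadd (v : V) : -hQ.shift v +ᵥ v = hQ.base v := by
  rw [neg_vadd_eq_iff, hQ.shift_vadd_base]

theorem shift_vadd_mem (γ : Fin d → ℤ) {q : V} (hq : q ∈ Q) : hQ.shift (γ +ᵥ q) = γ :=
  (congrArg Prod.fst ((hQ (γ +ᵥ q)).choose_spec.2 (γ, q) ⟨hq, rfl⟩)).symm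

theorem base_vadd_mem (γ : Fin d → ℤ) {q : V} (hq : q ∈ Q) : hQ.base (γ +ᵥ q) = q :=
  (congrArg Prod.snd ((hQ (γ +ᵥ q)).choose_spec.2 (γ, q) ⟨hq, rfl⟩)).symm

theorem shift_mem {q : V} (hq : q ∈ Q) : hQ.shift q = 0 := by
  simpa using hQ.shift_vadd_mem 0 hq

theorem base_of_mem {q : V} (hq : q ∈ Q) : hQ.base q = q := by
  simpa using hQ.base_vadd_mem 0 hq

theorem shift_vadd (γ : Fin d → ℤ) (v : V) : hQ.shift (γ +ᵥ v) = γ + hQ.shift v := by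
  conv_lhs => rw [← hQ.shift_vadd_base v, vadd_vadd]
  exact hQ.shift_vadd_mem _ (hQ.base_mem v)

theorem base_vadd (γ : Fin d → ℤ) (v : V) : hQ.base (γ +ᵥ v) = hQ.base v := by
  conv_lhs => rw [← hQ.shift_vadd_base v, vadd_vadd]
  exact hQ.base_vadd_mem _ (hQ.base_mem v)

theorem apply_eq_phase_mul {θ : Torus d} {f : V → ℂ} (hf : f ∈ pseudoperiodic V θ) (v : V) :
    f v = phase θ (hQ.shift v) * f (hQ.base v) := by
  conv_lhs => rw [← hQ.shift_vadd_base v]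
  exact hf _ _

/-- A pseudoperiodic function is determined by its values on the fundamental domain. -/
def restrictEquiv (θ : Torus d) : pseudoperiodic V θ ≃ₗ[ℂ] (Q → ℂ) where
  toFun f q := f.1 q
  map_add' f g := rfl
  map_smul' c f := rfl
  invFun g := ⟨fun v => phase θ (hQ.shift v) * g ⟨hQ.base v, hQ.base_mem v⟩, fun γ v => by
    simp only [hQ.shift_vadd, hQ.base_vadd, phase_add_right, mul_assoc]⟩
  left_inv f := Subtype.ext <| funext fun v => (hQ.apply_eq_phase_mul f.2 v).symm
  right_inv g := funext fun q => by
    simp [hQ.shift_mem q.2, hQ.base_of_mem q.2, phase_zero_right]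

/-- The basis of `ℓ²(V)_θ` given by the fundamental domain. -/
def pseudoperiodicBasis (θ : Torus d) : Module.Basis Q ℂ (pseudoperiodic V θ) :=
  .ofEquivFun (hQ.restrictEquiv θ)

open Classical in
/-- The `θ`-pseudoperiodic extension of the indicator function of `{q}`, `q ∈ Q`. -/
def pseudoDelta (q : V) (θ : Torus d) (v : V) : ℂ :=
  if hQ.base v = q then phase θ (hQ.shift v) else 0

theorem coe_pseudoperiodicBasis (θ : Torus d) (q : Q) :
    (hQ.pseudoperiodicBasis θ q : V → ℂ) = hQ.pseudoDelta q θ := by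
  classical
  have h : hQ.pseudoperiodicBasis θ q = (hQ.restrictEquiv θ).symm (Pi.single q 1) := by
    rw [pseudoperiodicBasis, Module.Basis.coe_ofEquivFun]
  rw [h]
  ext v
  change phase θ (hQ.shift v) * (Pi.single q 1 : Q → ℂ) ⟨hQ.base v, hQ.base_mem v⟩ = _
  simp [pseudoDelta, Pi.single_apply, Subtype.ext_iff]

theorem pseudoperiodicBasis_repr (θ : Torus d) (f : pseudoperiodic V θ) (q : Q) :
    (hQ.pseudoperiodicBasis θ).repr f q = f.1 q := rfl

theorem continuous_pseudoDelta (q v : V) : Continuous fun θ => hQ.pseudoDelta q θ v := by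
  unfold pseudoDelta
  split_ifs
  · exact continuous_phase _
  · exact continuous_const

/-- On the orbit of $q$ the integrand is the character of the shift of $v$; its integral survives
only for shift 0, that is, at $v=q$. -/
theorem integral_pseudoDelta [DecidableEq V] {q : V} (hq : q ∈ Q) (v : V) :
    ∫ θ, hQ.pseudoDelta q θ v = (((2 * Real.pi) ^ d : ℝ) : ℂ) * (Pi.single q 1 : V → ℂ) v := by
  unfold pseudoDelta
  rw [Pi.single_apply]
  split_ifs with h1 h2 h2
  · rw [integral_phase, h2, if_pos (hQ.shift_mem hq), mul_one]
  · rw [integral_phase, if_neg, mul_zero]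
    intro h3
    apply h2
    rw [← hQ.shift_vadd_base v, h3, h1, zero_vadd]
  · subst h2
    exact absurd (hQ.base_of_mem hq) h1
  · simp

end IsFundamentalDomain

/-- The mass transport principle. -/
theorem IsFundamentalDomain.sum_sum_neighborFinset_comm (hQ : IsFundamentalDomain d Q)
    {G : SimpleGraph V} [G.LocallyFinite] (hG : ActsByAutomorphisms G d) (F : V → V → ℂ)
    (hF : ∀ (γ : Fin d → ℤ) v w, F (γ +ᵥ v) (γ +ᵥ w) = F v w) :
    ∑ q ∈ Q, ∑ w ∈ G.neighborFinset q, F q w = ∑ q ∈ Q, ∑ w ∈ G.neighborFinset q, F w q := by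
  -- Reverse the oriented edge $(q,w)$ and translate it so that its new origin lies in $Q$. This is
  -- an involution on the edges that start in $Q$.
  let i : (_ : V) × V → (_ : V) × V := fun x => ⟨hQ.base x.2, -hQ.shift x.2 +ᵥ x.1⟩
  have hmem : ∀ x ∈ Q.sigma fun q => G.neighborFinset q,
      i x ∈ Q.sigma fun q => G.neighborFinset q := fun x hx => by
    rw [Finset.mem_sigma, SimpleGraph.mem_neighborFinset] at hx ⊢
    refine ⟨hQ.base_mem _, ?_⟩
    have h := (hG (-hQ.shift x.2) _ _).2 hx.2.symm
    rwa [hQ.neg_shift_vadd] at h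
  have hinv : ∀ x ∈ Q.sigma fun q => G.neighborFinset q, i (i x) = x := fun x hx => by
    obtain ⟨q, w⟩ := x
    have hq : q ∈ Q := (Finset.mem_sigma.1 hx).1
    simp only [i, hQ.base_vadd_mem _ hq, hQ.shift_vadd_mem _ hq, neg_neg, hQ.shift_vadd_base]
  rw [Finset.sum_sigma', Finset.sum_sigma']
  refine Finset.sum_nbij' i i hmem hmem hinv hinv fun x _ => ?_
  rw [← hF (-hQ.shift x.2), hQ.neg_shift_vadd]

theorem IsFundamentalDomain.finrank_pseudoperiodic (hQ : IsFundamentalDomain d Q) (θ : Torus d) :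
    Module.finrank ℂ (pseudoperiodic V θ) = Q.card := by
  rw [Module.finrank_eq_card_basis (hQ.pseudoperiodicBasis θ), Fintype.card_coe]

end FundamentalDomain

/-! ### Diagonalization, eigenvalue bounds and moments of $\Delta^\theta$ -/

section FloquetLaplacian

variable {V : Type u} {G : SimpleGraph V} [G.LocallyFinite] {d : ℕ} [AddAction (Fin d → ℤ) V]
  {Q : Finset V}

/-- The inner product on `ℓ²(V)_θ` with weights `c` on the fundamental domain. -/
@[reducible] def IsFundamentalDomain.core (hQ : IsFundamentalDomain d Q) (θ : Torus d)
    (c : V → Set.Ioi (0 : ℝ)) :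
    InnerProductSpace.Core ℂ (pseudoperiodic V θ) where
  inner f g := ∑ q ∈ Q, ((c q : ℝ) : ℂ) * (conj (f.1 q) * g.1 q)
  conj_inner_symm f g := by simp [mul_comm]
  re_inner_nonneg f := by
    rw [map_sum]
    refine Finset.sum_nonneg fun q _ => ?_
    rw [← Complex.normSq_eq_conj_mul_self, ← Complex.ofReal_mul]
    exact mul_nonneg (c q).2.le (Complex.normSq_nonneg _)
  add_left f g h := by simp [add_mul, mul_add, Finset.sum_add_distrib]
  smul_left f g r := by
    simp only [Submodule.coe_smul, Pi.smul_apply, smul_eq_mul, map_mul, Finset.mul_sum]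
    exact Finset.sum_congr rfl fun q _ => by ring
  definite f h := by
    simp only [← Complex.normSq_eq_conj_mul_self, ← Complex.ofReal_mul, ← Complex.ofReal_sum] at h
    rw [Complex.ofReal_eq_zero, Finset.sum_eq_zero_iff_of_nonneg fun q _ =>
      mul_nonneg (c q).2.le (Complex.normSq_nonneg _)] at h
    refine (hQ.restrictEquiv θ).injective (funext fun q => ?_)
    exact Complex.normSq_eq_zero.1 ((mul_eq_zero.1 (h q q.2)).resolve_left (c q).2.ne')

/-- At an isolated vertex both sides vanish, so the weight there is arbitrary. -/
theorem degree_mul_averageFun {c : ℝ} {v : V} (hc : G.degree v ≠ 0 → c = G.degree v) (f : V → ℂ) :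
    (c : ℂ) * averageFun G f v = ∑ w ∈ G.neighborFinset v, f w := by
  change (c : ℂ) * ((1 / (G.degree v : ℂ)) * ∑ w ∈ G.neighborFinset v, f w) = _
  by_cases h : G.degree v = 0
  · have h2 : G.neighborFinset v = ∅ := Finset.card_eq_zero.1 h
    simp [h2]
  · have h2 : (G.degree v : ℂ) ≠ 0 := by exact_mod_cast h
    rw [hc h, Complex.ofReal_natCast]
    field_simp

/-- $\Delta^\theta$ is symmetric for the degree-weighted inner product over $Q$: the averaging terms
become sums over edges starting in $Q$, and mass transport exchanges the two ends. -/
theorem exists_floquet_eigenbasis (hG : ActsByAutomorphisms G d) (hQ : IsFundamentalDomain d Q)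
    (θ : Torus d) : ∃ (b : Module.Basis (Fin Q.card) ℂ (pseudoperiodic V θ)) (l : Fin Q.card → ℝ),
      ∀ i, floquetLaplacian hG θ (b i) = (l i : ℂ) • b i := by
  -- The weight $m$ need not be invariant under the action; the degree is.
  obtain ⟨c, -, hc⟩ := exists_isSymmetrizing G
  have : FiniteDimensional ℂ (pseudoperiodic V θ) :=
    Module.Finite.of_basis (hQ.pseudoperiodicBasis θ)
  refine exists_eigenbasis (hQ.core θ c) _ (fun f g => ?_) (hQ.finrank_pseudoperiodic θ)
  -- Invariant under the action because the phases of $\bar f$ and $g$ cancel.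
  have h := hQ.sum_sum_neighborFinset_comm hG (fun v w => conj (f.1 v) * g.1 w) fun γ v w => by
    rw [f.2 γ v, g.2 γ w, map_mul]
    linear_combination (conj (f.1 v) * g.1 w) * conj_phase_mul_phase θ γ
  change ∑ q ∈ Q, ((c q : ℝ) : ℂ) * (conj (f.1 q - averageFun G f.1 q) * g.1 q) =
    ∑ q ∈ Q, ((c q : ℝ) : ℂ) * (conj (f.1 q) * (g.1 q - averageFun G g.1 q))
  have h1 : ∀ q, ((c q : ℝ) : ℂ) * (conj (f.1 q - averageFun G f.1 q) * g.1 q) =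
      c q * (conj (f.1 q) * g.1 q) - ∑ w ∈ G.neighborFinset q, conj (f.1 w) * g.1 q := fun q => by
    have h2 := congrArg conj (degree_mul_averageFun (hc q) f.1)
    rw [map_mul, Complex.conj_ofReal, map_sum] at h2
    rw [← Finset.sum_mul, ← h2, map_sub]
    ring
  have h2 : ∀ q, ((c q : ℝ) : ℂ) * (conj (f.1 q) * (g.1 q - averageFun G g.1 q)) =
      c q * (conj (f.1 q) * g.1 q) - ∑ w ∈ G.neighborFinset q, conj (f.1 q) * g.1 w := fun q => by
    rw [← Finset.mul_sum, ← degree_mul_averageFun (hc q) g.1]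
    ring
  simp only [h1, h2, Finset.sum_sub_distrib, h]

theorem norm_averageFun_le {f : V → ℂ} {M : ℝ} (hM : ∀ v, ‖f v‖ ≤ M) (v : V) :
    ‖averageFun G f v‖ ≤ M := by
  have hM0 : 0 ≤ M := (norm_nonneg _).trans (hM v)
  change ‖(1 / (G.degree v : ℂ)) * ∑ w ∈ G.neighborFinset v, f w‖ ≤ M
  have h1 : ‖∑ w ∈ G.neighborFinset v, f w‖ ≤ G.degree v * M := by
    refine (norm_sum_le _ _).trans ((Finset.sum_le_sum fun w _ => hM w).trans ?_)
    simp
  rw [norm_mul, norm_div, norm_one, Complex.norm_natCast, one_div]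
  calc _ ≤ (G.degree v : ℝ)⁻¹ * (G.degree v * M) := by gcongr
    _ ≤ M := by
      rw [← mul_assoc]
      exact mul_le_of_le_one_left hM0 (inv_mul_le_one)

/-- The modulus of a pseudoperiodic function is periodic, so it attains its maximum on $Q$; there
the average is no larger than the value itself. The bound is uniform in $\theta$, as the
approximation argument requires. -/
theorem abs_le_two_of_floquetLaplacian_eq (hG : ActsByAutomorphisms G d)
    (hQ : IsFundamentalDomain d Q) {θ : Torus d} {f : pseudoperiodic V θ} (hf : f ≠ 0) {μ : ℝ}
    (h : floquetLaplacian hG θ f = (μ : ℂ) • f) : |μ| ≤ 2 := by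
  have hn : ∀ v, ‖f.1 v‖ = ‖f.1 (hQ.base v)‖ := fun v => by
    rw [hQ.apply_eq_phase_mul f.2 v, norm_mul, norm_phase, one_mul]
  obtain ⟨v, hv⟩ : ∃ v, f.1 v ≠ 0 := by
    by_contra! h0
    exact hf (Subtype.ext (funext h0))
  obtain ⟨q, -, hq⟩ := Q.exists_max_image (fun q => ‖f.1 q‖) ⟨_, hQ.base_mem v⟩
  have hM : ∀ w, ‖f.1 w‖ ≤ ‖f.1 q‖ := fun w => (hn w).trans_le (hq _ (hQ.base_mem w))
  have hpos : 0 < ‖f.1 q‖ := (norm_pos_iff.2 hv).trans_le (hM v)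
  have h1 : f.1 q - averageFun G f.1 q = μ * f.1 q := congrFun (congrArg Subtype.val h) q
  have h2 := norm_sub_le (f.1 q) (averageFun G f.1 q)
  rw [h1, norm_mul, Complex.norm_real, Real.norm_eq_abs] at h2
  have h3 := norm_averageFun_le (G := G) hM q
  exact le_of_mul_le_mul_right (by linarith) hpos

theorem trace_floquetLaplacian_pow (hG : ActsByAutomorphisms G d) (hQ : IsFundamentalDomain d Q)
    (θ : Torus d) (k : ℕ) : LinearMap.trace ℂ _ (floquetLaplacian hG θ ^ k) =
      ∑ q ∈ Q, (laplacianFun G ^ k) (hQ.pseudoDelta q θ) q := by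
  classical
  rw [LinearMap.trace_eq_matrix_trace ℂ (hQ.pseudoperiodicBasis θ), Matrix.trace,
    ← Finset.sum_coe_sort Q]
  refine Finset.sum_congr rfl fun q _ => ?_
  rw [Matrix.diag_apply, LinearMap.toMatrix_apply, hQ.pseudoperiodicBasis_repr,
    floquetLaplacian, Module.End.pow_restrict, ← hQ.coe_pseudoperiodicBasis]
  rfl

/-- $(\Delta^kf)(v)$ is a finite linear combination of values of $f$, so it commutes with the
integral; continuity on a compact space provides integrability. -/
theorem laplacianFun_pow_integral {Θ : Type*} [TopologicalSpace Θ] [CompactSpace Θ]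
    [MeasurableSpace Θ] [BorelSpace Θ] (ν : Measure Θ) [IsFiniteMeasure ν]
    (k : ℕ) {F : Θ → V → ℂ} (hF : ∀ v, Continuous fun θ => F θ v) :
    (∀ v, Continuous fun θ => (laplacianFun G ^ k) (F θ) v) ∧
      ∀ v, ∫ θ, (laplacianFun G ^ k) (F θ) v ∂ν =
        (laplacianFun G ^ k) (fun w => ∫ θ, F θ w ∂ν) v := by
  induction k with
  | zero => exact ⟨hF, fun v => rfl⟩
  | succ k ih =>
    obtain ⟨hc, hi⟩ := ih
    simp only [pow_succ', Module.End.mul_apply, laplacianFun_apply]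
    have hint : ∀ v, Integrable (fun θ => (laplacianFun G ^ k) (F θ) v) ν := fun v =>
      (hc v).integrable_of_hasCompactSupport (HasCompactSupport.of_compactSpace _)
    refine ⟨fun v => (hc v).sub (continuous_const.mul (continuous_finsetSum _ fun w _ => hc w)),
      fun v => ?_⟩
    rw [integral_sub (hint v) ((integrable_finsetSum _ fun w _ => hint w).const_mul _),
      integral_const_mul, integral_finsetSum _ fun w _ => hint w]
    simp only [hi]

end FloquetLaplacian

/-! ### Matrix elements in $\ell^2(\mathcal V,m)$ -/

section Hilbert

variable {V : Type u} {G : SimpleGraph V} [G.LocallyFinite] {m : V → Set.Ioi (0 : ℝ)}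

open Classical in
/-- The normalized indicator function of `{q}` in `ℓ²(V, m)`. -/
def unitVector (m : V → Set.Ioi (0 : ℝ)) (q : V) : L2 m :=
  lp.single 2 q (WeightedLine.val.symm ((√(m q : ℝ) : ℂ)⁻¹))

theorem sqrt_weight_ne_zero (m : V → Set.Ioi (0 : ℝ)) (q : V) : (√(m q : ℝ) : ℂ) ≠ 0 := by
  have h : √(m q : ℝ) ≠ 0 := (Real.sqrt_pos.2 (m q).2).ne'
  exact_mod_cast h

theorem toFun_unitVector [DecidableEq V] (q : V) :
    toFun (unitVector m q) = ((√(m q : ℝ) : ℂ)⁻¹) • (Pi.single q 1 : V → ℂ) := by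
  ext v
  by_cases h : v = q
  · subst h
    simp [toFun, unitVector]
  · simp [toFun, unitVector, h]

theorem inner_unitVector (q : V) (f : L2 m) :
    inner ℂ (unitVector m q) f = (√(m q : ℝ) : ℂ) * toFun f q := by
  classical
  have h : (((m q : ℝ)) : ℂ) = (√(m q : ℝ) : ℂ) * (√(m q : ℝ) : ℂ) := by
    rw [← Complex.ofReal_mul, Real.mul_self_sqrt (m q).2.le]
  have h0 := sqrt_weight_ne_zero m q
  rw [unitVector, lp.inner_single_left, WeightedLine.inner_def, h, LinearEquiv.apply_symm_apply,
    map_inv₀, Complex.conj_ofReal]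
  change _ = _ * (f q).val
  field_simp

theorem cutoff_eq_sum (Q : Finset V) (f : L2 m) :
    cutoff m (Q : Set V) f = ∑ q ∈ Q, inner ℂ (unitVector m q) f • unitVector m q := by
  classical
  refine toFun_injective (funext fun v => ?_)
  rw [toFun_cutoff, map_sum, Finset.sum_apply]
  have h : ∀ q, toFun (inner ℂ (unitVector m q) f • unitVector m q) v =
      if v = q then toFun f q else 0 := fun q => by
    have h0 := sqrt_weight_ne_zero m q
    rw [map_smul, toFun_unitVector, inner_unitVector]
    simp only [Pi.smul_apply, smul_eq_mul, Pi.single_apply]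
    split_ifs
    · field_simp
    · simp
  simp [h, Set.indicator_apply]

theorem toFun_laplacian_pow (hm : IsSymmetrizing G m) (k : ℕ) (f : L2 m) :
    toFun ((laplacian hm ^ k) f) = (laplacianFun G ^ k) (toFun f) := by
  induction k with
  | zero => rfl
  | succ k ih =>
    rw [pow_succ', pow_succ', Module.End.mul_apply, ← ih, ← toFun_laplacian hm]
    rfl

/-- The factors $\sqrt{m(q)}$ cancel: diagonal matrix elements do not see the weight, which is why
they can be compared with traces of $\Delta^\theta$. -/
theorem inner_unitVector_laplacian_pow [DecidableEq V] (hm : IsSymmetrizing G m) (k : ℕ) (q : V) :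
    inner ℂ (unitVector m q) ((laplacian hm ^ k) (unitVector m q)) =
      (laplacianFun G ^ k) (Pi.single q 1) q := by
  have h0 := sqrt_weight_ne_zero m q
  rw [inner_unitVector, toFun_laplacian_pow, toFun_unitVector, map_smul, Pi.smul_apply,
    smul_eq_mul, mul_inv_cancel_left₀ h0]

theorem norm_mkOp_le (A : (V → ℂ) →ₗ[ℂ] (V → ℂ))
    (hA : ∀ (f : L2 m) (s : Finset V), ∑ v ∈ s, (m v : ℝ) * ‖A (toFun f) v‖ ^ 2 ≤ ‖f‖ ^ 2) :
    ‖mkOp A hA‖ ≤ 1 := by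
  refine ContinuousLinearMap.opNorm_le_bound _ zero_le_one fun f => ?_
  rw [one_mul]
  refine lp.norm_le_of_forall_sum_le (p := 2) (by norm_num) (norm_nonneg _) fun s => ?_
  simp only [ENNReal.toReal_ofNat, Real.rpow_ofNat, WeightedLine.norm_sq]
  exact hA f s

theorem norm_laplacian_le (hm : IsSymmetrizing G m) : ‖laplacian hm‖ ≤ 2 := by
  have h1 : ‖mkOp (averageFun G) (sum_average_le hm)‖ ≤ 1 := norm_mkOp_le _ _
  refine (norm_sub_le _ _).trans ?_
  linarith [ContinuousLinearMap.norm_id_le (𝕜 := ℂ) (E := L2 m)]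

end Hilbert

/-- The moment identity: expand the trace of $(\Delta^\theta)^k$ in the basis $\delta_q^\theta$,
integrate inside $\Delta^k$, and use that the mean of $\delta_q^\theta$ over the torus is
$\delta_q$. -/
theorem traceIdentity_pow {V : Type u} {G : SimpleGraph V} [G.LocallyFinite] {d : ℕ}
    [AddAction (Fin d → ℤ) V] (hG : ActsByAutomorphisms G d) {Q : Finset V}
    (hQ : IsFundamentalDomain d Q) {m : V → Set.Ioi (0 : ℝ)} (hm : IsSymmetrizing G m)
    {b : ∀ θ : Torus d, Module.Basis (Fin Q.card) ℂ (pseudoperiodic V θ)}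
    {l : Torus d → Fin Q.card → ℝ}
    (hl : ∀ θ i, floquetLaplacian hG θ (b θ i) = (l θ i : ℂ) • b θ i) (k : ℕ) :
    TraceIdentity volume l (laplacian hm) Q (unitVector m) ((2 * Real.pi) ^ d)
      (fun t => t ^ k) := by
  classical
  have hA := isSelfAdjoint_laplacian hm
  have htr : ∀ θ, ((∑ i, l θ i ^ k : ℝ) : ℂ) =
      ∑ q ∈ Q, (laplacianFun G ^ k) (hQ.pseudoDelta q θ) q := fun θ => by
    rw [← trace_floquetLaplacian_pow hG hQ, trace_pow_eq_sum_pow (b θ) (hl θ), Complex.ofReal_sum]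
  have hF := fun q => laplacianFun_pow_integral (G := G) (volume : Measure (Torus d)) k
    (F := hQ.pseudoDelta q) (fun v => hQ.continuous_pseudoDelta q v)
  have hint : ∀ q, Integrable fun θ : Torus d => (laplacianFun G ^ k) (hQ.pseudoDelta q θ) q :=
    fun q => ((hF q).1 q).integrable_of_hasCompactSupport (HasCompactSupport.of_compactSpace _)
  have hsum : Integrable fun θ : Torus d => ((∑ i, l θ i ^ k : ℝ) : ℂ) := by
    simp only [htr]
    exact integrable_finsetSum _ fun q _ => hint q
  refine ⟨by simpa only [Complex.ofReal_re] using! hsum.re, ?_⟩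
  rw [← integral_complex_ofReal]
  simp only [htr]
  rw [integral_finsetSum _ fun q _ => hint q, Finset.mul_sum, cfc_pow_id (laplacian hm) k]
  refine Finset.sum_congr rfl fun q hq => ?_
  rw [(hF q).2, inner_unitVector_laplacian_pow]
  have h : (fun w => ∫ θ, hQ.pseudoDelta q θ w) =
      (((2 * Real.pi) ^ d : ℝ) : ℂ) • (Pi.single q 1 : V → ℂ) :=
    funext fun w => hQ.integral_pseudoDelta hq w
  rw [h, map_smul]
  rfl

end PeriodicGraph

end

theorem mainTheorem1 {V : Type*} [Nonempty V] (G : SimpleGraph V) [G.LocallyFinite]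
    {d : ℕ} [AddAction (Fin d → ℤ) V] (hG : PeriodicGraph.ActsByAutomorphisms G d)
    (Q : Finset V) (hQ : PeriodicGraph.IsFundamentalDomain d Q)
    (m : V → Set.Ioi (0 : ℝ)) (hm : PeriodicGraph.IsSymmetrizing G m) (E : ℝ) :
    (∃ t : ℂ, PeriodicGraph.HasTrace (PeriodicGraph.localizedProjector hm Q E) t) ∧
    MeasureTheory.Integrable
      (fun θ : PeriodicGraph.Torus d => (PeriodicGraph.eigenvalueCount hG θ E : ℝ)) ∧
    PeriodicGraph.ids hm Q E =
      ((1 / ((2 * Real.pi) ^ d * (Q.card : ℝ)) *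
        ∫ θ : PeriodicGraph.Torus d, (PeriodicGraph.eigenvalueCount hG θ E : ℝ) : ℝ) : ℂ) := by
  have htrace : PeriodicGraph.HasTrace (PeriodicGraph.localizedProjector hm Q E) _ :=
    PeriodicGraph.hasTrace_comp_of_eq_sum Q (PeriodicGraph.unitVector m)
      (PeriodicGraph.cutoff_eq_sum Q)
      (PeriodicGraph.isSelfAdjoint_spectralProjector (PeriodicGraph.laplacian hm) E)
  -- The choice need not be measurable in $\theta$: only sums over all eigenvalues are integrated,
  -- and for powers these are traces, continuous in $\theta$.
  choose b l hl using PeriodicGraph.exists_floquet_eigenbasis hG hQ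
  have hcount : ∀ θ, PeriodicGraph.eigenvalueCount hG θ E =
      (Finset.univ.filter fun i => l θ i ≤ E).card := fun θ =>
    PeriodicGraph.finsum_finrank_eigenspace (b θ) (hl θ) E
  obtain ⟨hint, heq⟩ := PeriodicGraph.integral_card_eq_sum_spectralProjector
    (PeriodicGraph.isSelfAdjoint_laplacian hm) (PeriodicGraph.norm_laplacian_le hm)
    (fun θ i => PeriodicGraph.abs_le_two_of_floquetLaplacian_eq hG hQ ((b θ).ne_zero i) (hl θ i))
    (PeriodicGraph.traceIdentity_pow hG hQ hm hl) E
  simp only [hcount]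
  refine ⟨⟨_, htrace⟩, hint, ?_⟩
  have hpi : (((2 * Real.pi) ^ d : ℝ) : ℂ) ≠ 0 := by
    exact_mod_cast (pow_pos Real.two_pi_pos d).ne'
  rw [PeriodicGraph.ids, htrace.trace_eq, Complex.ofReal_mul, heq, Complex.ofReal_div,
    Complex.ofReal_mul, Complex.ofReal_one, Complex.ofReal_natCast, one_div, one_div, mul_inv,
    mul_comm (((2 * Real.pi) ^ d : ℝ) : ℂ)⁻¹, mul_assoc, inv_mul_cancel_left₀ hpi]
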